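/- Let $X=\{a,b\}$ be a binary alphabet with first letter $a$ and second letter $b$. Let $X^*$ be the free monoid on $X$, and let $\mathrm{Hom}(X^*)$ be the monoid of all monoid morphisms $X^*\to X^*$, with composition as product. A morphism $g$ is called upper triangular if its matrix $\left(|g(y)|_x\right)_{x,y\in X}$ is upper triangular, where $|w|_x$ is the number of occurrences of the letter $x$ in the word $w$; equivalently, $g(a)\in a^*$. Two words $u,v\in X^*$ are called $a$-conjugates if there are nonnegative integers $i,j,k,l$ and a word $w\in X^*$ such that $u=a^iwa^j$, $v=a^kwa^l$ and $i+j=k+l$. Let $g_1,g_2$ be upper triangular morphisms such that $$g_1(a)=a^s,\qquad g_1(b)=a^{\gamma_1}ba^{\alpha_1}ba^{\alpha_2}b\cdots ba^{\alpha_{p-1}}ba^{\gamma_2},$$ $$g_2(a)=a^t,\qquad g_2(b)=a^{\delta_1}ba^{\beta_1}ba^{\beta_2}b\cdots ba^{\beta_{q-1}}ba^{\delta_2},$$ where $s,t\ge 1$ and $p,q\ge 2$ are integers and $\gamma_1,\gamma_2,\delta_1,\delta_2,\alpha_1,\ldots,\alpha_{p-1},\beta_1,\ldots,\beta_{q-1}$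 are nonnegative integers. Assume that $p=r^m$ and $q=r^n$, where $m,n,r$ are positive integers. Then $g_1g_2=g_2g_1$ if and only if at least one of the following conditions holds: (i) $g_1^n=g_2^m$; (ii) $g_1(b)\in b^*$ and $g_2(b)\in b^*$; (iii) $g_1(a)=g_2(a)=a$, and the words $g_1^n(b)$ and $g_2^m(b)$ are $a$-conjugates. -/

import Mathlib

namespace TriMorphism

/-- `Hom(X^*)`: the monoid of all morphisms of the free monoid `X^*` into itself. The product is
composition, `(g * h) w = g (h w)`. -/
abbrev Hom (X : Type*) : Type _ := Monoid.End (FreeMonoid X)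

/-- The matrix of a morphism: the entry in row `x` and column `y` is the number of occurrences of
the letter `x` in `h(y)`. -/
def matrix {X : Type*} [DecidableEq X] (h : Hom X) : Matrix X X ℕ :=
  Matrix.of fun x y => (h (FreeMonoid.of y)).toList.count x

/-- A morphism is upper triangular if its matrix is: all entries below the diagonal vanish. -/
def IsUpperTriangular {X : Type*} [LinearOrder X] (h : Hom X) : Prop :=
  (matrix h).BlockTriangular id

/-- The first letter `a` of the binary alphabet `X = {a, b}`, as a word. The alphabet is
modelled by `Fin 2` with `a = 0 < 1 = b`. -/
abbrev a : FreeMonoid (Fin 2) := FreeMonoid.of 0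

/-- The second letter `b` of the binary alphabet, as a word. -/
abbrev b : FreeMonoid (Fin 2) := FreeMonoid.of 1

/-- The word `a^γ₁ b a^(α 0) b a^(α 1) b ⋯ b a^(α (k-1)) b a^γ₂`, which has `k + 1` occurrences
of `b`. -/
def word {k : ℕ} (γ₁ : ℕ) (α : Fin k → ℕ) (γ₂ : ℕ) : FreeMonoid (Fin 2) :=
  a ^ γ₁ * b * (List.ofFn fun i => a ^ α i * b).prod * a ^ γ₂

/-- Two binary words `u` and `v` are `a`-conjugates. -/
def AConjugates (u v : FreeMonoid (Fin 2)) : Prop :=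
  ∃ (p q r s : ℕ) (w : FreeMonoid (Fin 2)),
    u = a ^ p * w * a ^ q ∧ v = a ^ r * w * a ^ s ∧ p + q = r + s

end TriMorphism

namespace TriMorphism

/-! The exponents of `a` between consecutive `b`s in the image of `b` extend to one infinite
sequence `W`, fixed by `W (p * i) = s * W i + k` (`k` the sum of the two outer exponents) and by
`p`-periodicity off the multiples of `p`. All powers of the morphism have inner gaps given by `W`
(`HasGaps.pow`).

With `P = p ^ n = q ^ m`, the powers `g₁ ^ n` and `g₂ ^ m` have equally many `b`s in the image of
`b`. If `g₁` and `g₂` commute, so do these powers, and comparing gaps (`HasGaps.of_mul_comm`) makes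
the two sequences agree below `P` and relates multipliers `S`, `T` and outer exponents linearly. If
`S ≠ T`, every exponent vanishes, which is (ii); if `S = T > 1`, the outer exponents agree, which is
(i); if `S = T = 1`, only their sums agree, which is (iii).

Conversely, (i) and (iii) give both sequences the same recursion and the same first `P` terms, so
they coincide; `g₁ * g₂` and `g₂ * g₁` then have the same gaps. -/

/-! ### Words as products of blocks -/

/-- The word `∏_{i < n} a^(W i) b`. -/
def blocks (W : ℕ → ℕ) : ℕ → FreeMonoid (Fin 2)
  | 0 => 1
  | n + 1 => blocks W n * (a ^ W n * b)

theorem blocks_add (W : ℕ → ℕ) (m n : ℕ) :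
    blocks W (m + n) = blocks W m * blocks (fun i => W (m + i)) n := by
  induction n with
  | zero => simp [blocks]
  | succ n ih => rw [← add_assoc, blocks, ih, blocks, mul_assoc]

theorem pow_mul_blocks {x n : ℕ} {V W : ℕ → ℕ} (hn : 0 < n) (h0 : V 0 = x + W 0)
    (h : ∀ i, 0 < i → i < n → V i = W i) : a ^ x * blocks W n = blocks V n := by
  induction n with
  | zero => omega
  | succ n ih =>
    rcases Nat.eq_zero_or_pos n with rfl | hn
    · simp [blocks, h0, pow_add, mul_assoc]
    · rw [blocks, blocks, ← mul_assoc, ih hn fun i hi hin => h i hi (by omega),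
        h n hn (by omega)]

theorem blocks_congr {n : ℕ} {V W : ℕ → ℕ} (h : ∀ i < n, V i = W i) :
    blocks V n = blocks W n := by
  induction n with
  | zero => rfl
  | succ n ih => rw [blocks, blocks, ih fun i hi => h i (by omega), h n (by omega)]

theorem blocks_eq_pow {n : ℕ} {W : ℕ → ℕ} (h : ∀ i < n, W i = 0) : blocks W n = b ^ n := by
  induction n with
  | zero => rfl
  | succ n ih => rw [blocks, ih fun i hi => h i (by omega), h n (by omega), pow_zero, one_mul,
      pow_succ]

theorem a_pow_injective : Function.Injective fun n : ℕ => a ^ n := by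
  intro m n h
  have h' (k : ℕ) : (a ^ k).length = k := by
    induction k with
    | zero => rfl
    | succ k ih => rw [pow_succ, FreeMonoid.length_mul, ih, FreeMonoid.length_of]
  rw [← h' m, ← h' n]
  exact congrArg FreeMonoid.length h

theorem mul_a_ne_mul_b (u v : FreeMonoid (Fin 2)) : u * a ≠ v * b := by
  intro h
  have h' : u.toList ++ [(0 : Fin 2)] = v.toList ++ [1] := congrArg FreeMonoid.toList h
  simpa using (List.append_inj' h' rfl).2

theorem mul_b_mul_pow_inj {u v : FreeMonoid (Fin 2)} {d e : ℕ}
    (h : u * b * a ^ d = v * b * a ^ e) : u = v ∧ d = e := by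
  induction d generalizing e with
  | zero =>
    cases e with
    | zero => exact ⟨mul_right_cancel (b := b) (by simpa only [pow_zero, mul_one] using h), rfl⟩
    | succ e =>
      rw [pow_zero, mul_one, pow_succ, ← mul_assoc] at h
      exact absurd h.symm (mul_a_ne_mul_b _ _)
  | succ d ih =>
    cases e with
    | zero =>
      rw [pow_zero, mul_one, pow_succ, ← mul_assoc] at h
      exact absurd h (mul_a_ne_mul_b _ _)
    | succ e =>
      rw [pow_succ, pow_succ, ← mul_assoc, ← mul_assoc] at h
      obtain ⟨h1, h2⟩ := ih (mul_right_cancel h)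
      exact ⟨h1, by rw [h2]⟩

theorem blocks_mul_pow_inj {n d e : ℕ} {V W : ℕ → ℕ}
    (h : blocks V n * a ^ d = blocks W n * a ^ e) : d = e ∧ ∀ i < n, V i = W i := by
  induction n generalizing d e with
  | zero => exact ⟨a_pow_injective (by simpa [blocks] using h), by simp⟩
  | succ n ih =>
    rw [blocks, blocks, ← mul_assoc, ← mul_assoc] at h
    obtain ⟨h1, h2⟩ := mul_b_mul_pow_inj h
    obtain ⟨h3, h4⟩ := ih h1
    refine ⟨h2, fun i hi => ?_⟩
    rcases Nat.lt_succ_iff_lt_or_eq.1 hi with hi | rfl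
    exacts [h4 i hi, h3]

theorem pow_mul_blocks_mul_pow_inj {n c d e f : ℕ} {V W : ℕ → ℕ} (hn : 0 < n)
    (hV : V 0 = 0) (hW : W 0 = 0)
    (h : a ^ c * blocks V n * a ^ d = a ^ e * blocks W n * a ^ f) :
    c = e ∧ d = f ∧ ∀ i < n, V i = W i := by
  have key (x : ℕ) (U : ℕ → ℕ) (hU : U 0 = 0) :
      a ^ x * blocks U n = blocks (fun i => if i = 0 then x else U i) n :=
    pow_mul_blocks hn (by simp [hU]) fun i hi _ => by simp [hi.ne']
  rw [key c V hV, key e W hW] at h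
  obtain ⟨h1, h2⟩ := blocks_mul_pow_inj h
  refine ⟨by simpa using h2 0 hn, h1, fun i hi => ?_⟩
  rcases eq_or_ne i 0 with rfl | h0
  · rw [hV, hW]
  · simpa [h0] using h2 i hi

/-! ### Gaps of a composition -/

theorem mul_apply (g h : Hom (Fin 2)) (w : FreeMonoid (Fin 2)) : (g * h) w = g (h w) := rfl

theorem hom_ext {g h : Hom (Fin 2)} (ha : g a = h a) (hb : g b = h b) : g = h := by
  refine FreeMonoid.hom_eq fun x => ?_
  fin_cases x
  exacts [ha, hb]

/-- The morphism `g` maps `a` to `a^s`, and maps `b` to a word with `p` occurrences of `b` that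
starts with `a^c`, ends with `a^d`, and whose inner powers of `a` are given by `W`. -/
structure HasGaps (g : Hom (Fin 2)) (s p c d : ℕ) (W : ℕ → ℕ) : Prop where
  map_a : g a = a ^ s
  map_b : g b = a ^ c * blocks W p * a ^ d
  zero : W 0 = 0

/-- The inner powers of `a` in a composition. -/
def compGaps (p s k : ℕ) (W V : ℕ → ℕ) (i : ℕ) : ℕ :=
  if i = 0 then 0 else if p ∣ i then s * V (i / p) + k else W (i % p)

/-- Moving `a ^ d` across the word shifts each trailing `a ^ d` into the next image of `b`, so that
every image is preceded by the full `c + d`. -/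
theorem HasGaps.map_blocks {g : Hom (Fin 2)} {s p c d : ℕ} {W : ℕ → ℕ} (hg : HasGaps g s p c d W)
    (hp : 0 < p) (V : ℕ → ℕ) (k : ℕ) :
    a ^ d * g (blocks V k) =
      blocks (fun i => if p ∣ i then s * V (i / p) + (c + d) else W (i % p)) (p * k) * a ^ d := by
  induction k with
  | zero => simp [blocks]
  | succ k ih =>
    rw [mul_add, mul_one]
    set Y : ℕ → ℕ := fun i => if p ∣ i then s * V (i / p) + (c + d) else W (i % p)
    suffices hY : a ^ (d + s * V k + c) * blocks W p = blocks (fun i => Y (p * k + i)) p by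
      calc a ^ d * g (blocks V (k + 1))
          = (a ^ d * g (blocks V k)) * (a ^ (s * V k) * (a ^ c * blocks W p * a ^ d)) := by
            rw [blocks, map_mul, map_mul, map_pow, hg.map_a, hg.map_b, ← pow_mul]
            simp only [mul_assoc]
        _ = blocks Y (p * k) * (a ^ (d + s * V k + c) * blocks W p) * a ^ d := by
            rw [ih]
            simp only [pow_add, mul_assoc]
        _ = _ := by rw [hY, blocks_add]
    refine pow_mul_blocks hp ?_ fun i hi hip => ?_
    · simp only [Y, add_zero, dvd_mul_right, if_true, Nat.mul_div_cancel_left _ hp, hg.zero]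
      ring
    · have : ¬ p ∣ p * k + i := by
        rw [Nat.dvd_add_right (dvd_mul_right p k)]
        exact Nat.not_dvd_of_pos_of_lt hi hip
      simp only [Y, this, if_false, Nat.mul_add_mod, Nat.mod_eq_of_lt hip]

theorem HasGaps.mul {g h : Hom (Fin 2)} {s p c d t q e f : ℕ} {W V : ℕ → ℕ}
    (hg : HasGaps g s p c d W) (hh : HasGaps h t q e f V) (hp : 0 < p) (hq : 0 < q) :
    HasGaps (g * h) (s * t) (p * q) (s * e + c) (s * f + d) (compGaps p s (c + d) W V) := by
  refine ⟨?_, ?_, by simp [compGaps]⟩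
  · rw [mul_apply, hh.map_a, map_pow, hg.map_a, pow_mul]
  -- The extra factor `a ^ d` is the one needed by `map_blocks`.
  · refine mul_left_cancel (a := a ^ d) ?_
    have h1 : a ^ (c + d) * blocks (compGaps p s (c + d) W V) (p * q) =
        blocks (fun i => if p ∣ i then s * V (i / p) + (c + d) else W (i % p)) (p * q) := by
      refine pow_mul_blocks (Nat.mul_pos hp hq) ?_ fun i hi _ => ?_
      · simp [compGaps, hh.zero]
      · simp [compGaps, hi.ne']
    have h2 := hg.map_blocks hp V q
    rw [← h1] at h2
    calc a ^ d * (g * h) b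
        = a ^ (s * e) * (a ^ d * g (blocks V q)) * a ^ (s * f) := by
          have hd : a ^ d * a ^ (s * e) = a ^ (s * e) * a ^ d := by
            rw [← pow_add, ← pow_add, add_comm]
          rw [mul_apply, hh.map_b, map_mul, map_mul, map_pow, map_pow, hg.map_a, ← pow_mul,
            ← pow_mul, ← mul_assoc, ← mul_assoc, ← mul_assoc, hd]
      _ = a ^ (s * e + (c + d)) * blocks (compGaps p s (c + d) W V) (p * q) *
            a ^ (d + s * f) := by
          rw [h2]
          simp only [pow_add, mul_assoc]
      _ = a ^ (d + (s * e + c)) * blocks (compGaps p s (c + d) W V) (p * q) *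
            a ^ (s * f + d) := by
          rw [add_comm d (s * f), show s * e + (c + d) = d + (s * e + c) by ring]
      _ = a ^ d * (a ^ (s * e + c) * blocks (compGaps p s (c + d) W V) (p * q) *
            a ^ (s * f + d)) := by
          simp only [pow_add, mul_assoc]

theorem HasGaps.ext {g h : Hom (Fin 2)} {s p c d : ℕ} {V W : ℕ → ℕ}
    (hg : HasGaps g s p c d V) (hh : HasGaps h s p c d W) (hVW : ∀ i < p, V i = W i) : g = h :=
  hom_ext (by rw [hg.map_a, hh.map_a]) (by rw [hg.map_b, hh.map_b, blocks_congr hVW])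

theorem HasGaps.inj {g : Hom (Fin 2)} {s p c d t e f : ℕ} {V W : ℕ → ℕ}
    (hg : HasGaps g s p c d V) (hh : HasGaps g t p e f W) (hp : 0 < p) :
    s = t ∧ c = e ∧ d = f ∧ ∀ i < p, V i = W i :=
  ⟨a_pow_injective (hg.map_a.symm.trans hh.map_a),
    pow_mul_blocks_mul_pow_inj hp hg.zero hh.zero (hg.map_b.symm.trans hh.map_b)⟩

/-! ### Self-similar gap sequences -/

/-- The sequence `W` satisfies the recursion of the inner powers of `a` in the iterates of a
morphism with `p` occurrences of `b` in the image of `b`. -/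
structure SelfSimilar (W : ℕ → ℕ) (p s k : ℕ) : Prop where
  map_mul : ∀ i, 0 < i → W (p * i) = s * W i + k
  map_mod : ∀ i, ¬ p ∣ i → W (i % p) = W i

theorem SelfSimilar.compGaps {W : ℕ → ℕ} {p s k : ℕ} (h : SelfSimilar W p s k) (h0 : W 0 = 0) :
    compGaps p s k W W = W := by
  funext i
  unfold TriMorphism.compGaps
  split_ifs with hi hd
  · rw [hi, h0]
  · obtain ⟨j, rfl⟩ := hd
    have hp : 0 < p := Nat.pos_of_ne_zero (by rintro rfl; simp at hi)
    have hj : 0 < j := Nat.pos_of_ne_zero (by rintro rfl; simp at hi)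
    rw [Nat.mul_div_cancel_left _ hp, h.map_mul j hj]
  · exact h.map_mod i hd

/-- The sum `1 + s + ⋯ + s^(n-1)`. -/
def geom (s n : ℕ) : ℕ := ∑ i ∈ Finset.range n, s ^ i

theorem geom_succ (s n : ℕ) : geom s (n + 1) = s * geom s n + 1 := by
  simp [geom, Finset.sum_range_succ', Finset.mul_sum, pow_succ']

theorem geom_pos (s : ℕ) {n : ℕ} (hn : 0 < n) : 0 < geom s n := by
  obtain ⟨n, rfl⟩ := Nat.exists_eq_succ_of_ne_zero hn.ne'
  rw [Nat.succ_eq_add_one, geom_succ]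
  omega

theorem geom_mul (s n : ℕ) : geom s n * ((s : ℤ) - 1) = (s : ℤ) ^ n - 1 := by
  rw [geom]
  push_cast
  exact geom_sum_mul (s : ℤ) n

theorem SelfSimilar.pow {W : ℕ → ℕ} {p s k : ℕ} (h : SelfSimilar W p s k) (hp : 0 < p) (n : ℕ) :
    SelfSimilar W (p ^ n) (s ^ n) (k * geom s n) := by
  induction n with
  | zero => exact ⟨by simp [geom], by simp⟩
  | succ n ih =>
    refine ⟨fun i hi => ?_, fun i hi => ?_⟩
    · rw [pow_succ', mul_assoc, h.map_mul _ (by positivity), ih.map_mul i hi, geom_succ]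
      ring
    -- For `i = p * j`, the remainder modulo `p ^ (n + 1)` is `p * (j % p ^ n)`, which reduces the
    -- claim to `j`.
    · by_cases hd : p ∣ i
      · obtain ⟨j, rfl⟩ := hd
        rw [pow_succ', Nat.mul_dvd_mul_iff_left hp] at hi
        have hj : 0 < j := Nat.pos_of_ne_zero (by rintro rfl; simp at hi)
        have hj' : 0 < j % p ^ n := Nat.pos_of_ne_zero fun h0 => hi (Nat.dvd_of_mod_eq_zero h0)
        rw [pow_succ', Nat.mul_mod_mul_left, h.map_mul _ hj, h.map_mul _ hj', ih.map_mod j hi]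
      · have hd' : ¬ p ∣ i % p ^ (n + 1) := by
          rwa [Nat.dvd_mod_iff (dvd_pow_self p n.succ_ne_zero)]
        rw [← h.map_mod i hd, ← h.map_mod _ hd', Nat.mod_mod_of_dvd _ (dvd_pow_self p n.succ_ne_zero)]

theorem SelfSimilar.unique {V W : ℕ → ℕ} {p s k : ℕ} (hV : SelfSimilar V p s k)
    (hW : SelfSimilar W p s k) (hp : 1 < p) (h : ∀ i < p, V i = W i) : V = W := by
  funext i
  induction i using Nat.strong_induction_on with
  | _ i ih =>
    by_cases hi : i < p
    · exact h i hi
    by_cases hd : p ∣ i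
    · obtain ⟨j, rfl⟩ := hd
      have hj : 0 < j := Nat.pos_of_ne_zero (by rintro rfl; omega)
      rw [hV.map_mul j hj, hW.map_mul j hj, ih j (by nlinarith)]
    · rw [← hV.map_mod i hd, ← hW.map_mod i hd, h _ (Nat.mod_lt _ (by omega))]

/-- The self-similar sequence that starts with `α`. -/
def limitGaps (p s k : ℕ) (α : ℕ → ℕ) (i : ℕ) : ℕ :=
  if h : 1 < p ∧ 0 < i ∧ p ∣ i then s * limitGaps p s k α (i / p) + k else α (i % p)
termination_by i
decreasing_by exact Nat.div_lt_self h.2.1 h.1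

theorem limitGaps_of_lt {p s k : ℕ} {α : ℕ → ℕ} {i : ℕ} (hi : i < p) :
    limitGaps p s k α i = α i := by
  rw [limitGaps, dif_neg, Nat.mod_eq_of_lt hi]
  rintro ⟨-, h0, hd⟩
  exact Nat.not_dvd_of_pos_of_lt h0 hi hd

theorem selfSimilar_limitGaps {p : ℕ} (hp : 1 < p) (s k : ℕ) (α : ℕ → ℕ) :
    SelfSimilar (limitGaps p s k α) p s k := by
  refine ⟨fun i hi => ?_, fun i hi => ?_⟩
  · rw [limitGaps, dif_pos ⟨hp, by positivity, dvd_mul_right _ _⟩,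
      Nat.mul_div_cancel_left _ (by omega)]
  · rw [limitGaps_of_lt (Nat.mod_lt _ (by omega)), limitGaps, dif_neg fun h => hi h.2.2]

/-! ### Gaps of iterates -/

theorem HasGaps.pow {g : Hom (Fin 2)} {s p c d : ℕ} {W : ℕ → ℕ} (hg : HasGaps g s p c d W)
    (hW : SelfSimilar W p s (c + d)) (hp : 0 < p) (n : ℕ) :
    HasGaps (g ^ n) (s ^ n) (p ^ n) (c * geom s n) (d * geom s n) W := by
  induction n with
  | zero => exact ⟨by simp, by simp [geom, blocks, hg.zero], hg.zero⟩
  | succ n ih =>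
    have h := hg.mul ih hp (pow_pos hp n)
    rw [hW.compGaps hg.zero] at h
    simp only [pow_succ', geom_succ]
    convert h using 1 <;> ring

theorem word_eq (p c d : ℕ) (hp : 0 < p) (α : Fin (p - 1) → ℕ) (W : ℕ → ℕ) (h0 : W 0 = 0)
    (h : ∀ i : Fin (p - 1), W (i + 1) = α i) : word c α d = a ^ c * blocks W p * a ^ d := by
  have key (n : ℕ) (β : Fin n → ℕ) (V : ℕ → ℕ) (hV : ∀ i : Fin n, V i = β i) :
      (List.ofFn fun i => a ^ β i * b).prod = blocks V n := by
    induction n with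
    | zero => rfl
    | succ n ih =>
      rw [List.ofFn_succ', List.concat_eq_append, List.prod_append,
        ih (fun i => β i.castSucc) fun i => hV i.castSucc, blocks, List.prod_singleton,
        ← hV (Fin.last n), Fin.val_last]
  obtain ⟨n, rfl⟩ : ∃ n, p = 1 + n := ⟨p - 1, by omega⟩
  have hn : 1 + n - 1 = n := by omega
  rw [word, key _ α (fun i => W (1 + i)) fun i => by rw [add_comm, h i], blocks_add, hn]
  simp [blocks, h0, mul_assoc]

theorem exists_selfSimilar_hasGaps {g : Hom (Fin 2)} {s p c d : ℕ} (hp : 1 < p)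
    (α : Fin (p - 1) → ℕ) (ha : g a = a ^ s) (hb : g b = word c α d) :
    ∃ W, SelfSimilar W p s (c + d) ∧ HasGaps g s p c d W := by
  -- Index `0` is reserved for the normalising value `0`, hence the shift of `α` by one.
  let V : ℕ → ℕ := fun i => if h : 0 < i ∧ i - 1 < p - 1 then α ⟨i - 1, h.2⟩ else 0
  have h0 : limitGaps p s (c + d) V 0 = 0 := by
    rw [limitGaps_of_lt (by omega)]
    simp [V]
  refine ⟨limitGaps p s (c + d) V, selfSimilar_limitGaps hp _ _ _, ha, ?_, h0⟩
  rw [hb]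
  refine word_eq p c d (by omega) α _ h0 fun i => ?_
  rw [limitGaps_of_lt (by omega)]
  simp [V]

/-! ### Criteria for commutation and their consequences -/

/-- Composing along a common self-similar sequence returns that sequence, so only the outer
exponents remain to be compared. -/
theorem HasGaps.mul_comm_of {g h : Hom (Fin 2)} {s p c d t q e f : ℕ} {W : ℕ → ℕ}
    (hg : HasGaps g s p c d W) (hh : HasGaps h t q e f W) (hWg : SelfSimilar W p s (c + d))
    (hWh : SelfSimilar W q t (e + f)) (hp : 0 < p) (hq : 0 < q)
    (h1 : s * e + c = t * c + e) (h2 : s * f + d = t * d + f) : g * h = h * g := by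
  have hgh := hg.mul hh hp hq
  have hhg := hh.mul hg hq hp
  rw [hWg.compGaps hg.zero] at hgh
  rw [hWh.compGaps hg.zero, ← h1, ← h2, mul_comm t, mul_comm q] at hhg
  exact hgh.ext hhg fun _ _ => rfl

/-- The claim is `(s - 1) * e = (t - 1) * c`. Multiplying by both geometric sums, rather than
dividing by `s - 1`, also covers `s = 1`. -/
theorem mul_add_eq_of_geom {s t m n c e : ℕ} (hn : 0 < n) (hm : 0 < m) (hst : s ^ n = t ^ m)
    (hce : c * geom s n = e * geom t m) : s * e + c = t * c + e := by
  have h1 := geom_mul s n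
  have h2 := geom_mul t m
  have h3 : (s : ℤ) ^ n = (t : ℤ) ^ m := by exact_mod_cast hst
  have h4 : (c : ℤ) * geom s n = e * geom t m := by exact_mod_cast hce
  have h5 : (geom s n : ℤ) * geom t m ≠ 0 :=
    mul_ne_zero (by exact_mod_cast (geom_pos s hn).ne') (by exact_mod_cast (geom_pos t hm).ne')
  have h6 : ((s : ℤ) - 1) * e = ((t : ℤ) - 1) * c := by
    refine mul_left_cancel₀ h5 ?_
    linear_combination (e * geom t m : ℤ) * h1 - (c * geom s n : ℤ) * h2 +
      (e * geom t m : ℤ) * h3 - ((t : ℤ) ^ m - 1) * h4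
  zify
  linarith

/-- Since `T < S`, `h2` gives `K ≤ L`, so `(S - 1) * L = (T - 1) * K ≤ (T - 1) * L` forces `L = 0`.
-/
theorem eq_zero_of_lt {S T K L x : ℕ} (hT : 1 ≤ T) (hST : T < S) (h1 : S * L + K = T * K + L)
    (h2 : S * x + K = T * x + L) : K = 0 ∧ L = 0 ∧ x = 0 := by
  obtain ⟨e, rfl⟩ := Nat.exists_eq_add_of_lt hST
  obtain ⟨t, rfl⟩ := Nat.exists_eq_add_of_le hT
  have h3 : (e + 1) * x + K = L := by nlinarith
  have h4 : t * K ≤ t * L := Nat.mul_le_mul_left t (by omega)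
  have h5 : L + K = 0 := by nlinarith [Nat.zero_le (e * L)]
  have h6 : (e + 1) * x = 0 := by omega
  refine ⟨by omega, by omega, by simpa using h6⟩

theorem eq_zero_of_ne {S T K L x : ℕ} (hS : 1 ≤ S) (hT : 1 ≤ T) (hST : S ≠ T)
    (h1 : S * L + K = T * K + L) (h2 : S * x + K = T * x + L) : K = 0 ∧ L = 0 ∧ x = 0 := by
  rcases lt_or_gt_of_ne hST with h | h
  · obtain ⟨hL, hK, hx⟩ := eq_zero_of_lt hS h h1.symm h2.symm
    exact ⟨hK, hL, hx⟩
  · exact eq_zero_of_lt hT h h1 h2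

theorem HasGaps.map_b_eq_pow {g : Hom (Fin 2)} {s p c d n : ℕ} {W : ℕ → ℕ}
    (hg : HasGaps g s p c d W) (hn : 0 < n) (h : c * geom s n + d * geom s n = 0)
    (hW : ∀ i < p, W i = 0) : g b ∈ Submonoid.powers b := by
  have hpos := geom_pos s hn
  obtain ⟨hc, hd⟩ : c = 0 ∧ d = 0 := by
    have := Nat.add_eq_zero_iff.1 h
    simpa [hpos.ne'] using this
  refine ⟨p, ?_⟩
  rw [hg.map_b, blocks_eq_pow hW, hc, hd]
  simp

/-- Two commuting morphisms with equally many occurrences of `b` in the images of `b`. -/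
theorem HasGaps.of_mul_comm {g h : Hom (Fin 2)} {S T P C D E F : ℕ} {V W : ℕ → ℕ}
    (hg : HasGaps g S P C D V) (hh : HasGaps h T P E F W) (hP : 1 < P) (hgh : g * h = h * g) :
    (∀ i < P, V i = W i) ∧ S * E + C = T * C + E ∧ S * F + D = T * D + F ∧
      ∀ i, 0 < i → i < P → S * V i + (C + D) = T * V i + (E + F) := by
  have h1 := hg.mul hh (by omega) (by omega)
  have h2 := hh.mul hg (by omega) (by omega)
  rw [hgh] at h1
  obtain ⟨-, h3, h4, h5⟩ := h1.inj h2 (by positivity)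
  have hVW : ∀ i < P, V i = W i := by
    intro i hi
    rcases Nat.eq_zero_or_pos i with rfl | h0
    · rw [hg.zero, hh.zero]
    -- Indices below `P` show the inner gaps of the outer factor; multiples of `P` show the
    -- transformed gaps of the inner one.
    · have := h5 i (by nlinarith)
      simpa [compGaps, h0.ne', Nat.not_dvd_of_pos_of_lt h0 hi, Nat.mod_eq_of_lt hi] using this
  refine ⟨hVW, h3, h4, fun i h0 hi => ?_⟩
  have := h5 (P * i) (Nat.mul_lt_mul_of_pos_left hi (by omega))
  have hP0 : P ≠ 0 := by omega
  simpa [compGaps, h0.ne', hP0, Nat.mul_div_cancel_left _ (Nat.pos_of_ne_zero hP0), hVW i hi]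
    using this

theorem HasGaps.of_aConjugates {g h : Hom (Fin 2)} {S T P C D E F : ℕ} {V W : ℕ → ℕ}
    (hg : HasGaps g S P C D V) (hh : HasGaps h T P E F W) (hP : 0 < P)
    (hc : AConjugates (g b) (h b)) : C + D = E + F ∧ ∀ i < P, V i = W i := by
  obtain ⟨i, j, k, l, w, h1, h2, h3⟩ := hc
  rw [hg.map_b] at h1
  rw [hh.map_b] at h2
  -- Both words are padded to the common word `a ^ (k + i) * w * a ^ (j + l)`.
  have h4 : a ^ (k + C) * blocks V P * a ^ (D + l) = a ^ (i + E) * blocks W P * a ^ (F + j) := by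
    calc a ^ (k + C) * blocks V P * a ^ (D + l)
        = a ^ k * (a ^ C * blocks V P * a ^ D) * a ^ l := by simp only [pow_add, mul_assoc]
      _ = a ^ (k + i) * w * a ^ (j + l) := by rw [h1]; simp only [pow_add, mul_assoc]
      _ = a ^ (i + k) * w * a ^ (l + j) := by rw [add_comm k, add_comm j]
      _ = a ^ i * (a ^ E * blocks W P * a ^ F) * a ^ j := by
        rw [h2]; simp only [pow_add, mul_assoc]
      _ = a ^ (i + E) * blocks W P * a ^ (F + j) := by simp only [pow_add, mul_assoc]
  obtain ⟨h5, h6, h7⟩ := pow_mul_blocks_mul_pow_inj hP hg.zero hh.zero h4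
  exact ⟨by omega, h7⟩

end TriMorphism

/-! ### The main theorem -/

theorem mainTheorem2
    (g₁ g₂ : TriMorphism.Hom (Fin 2))
    (hg₁ : TriMorphism.IsUpperTriangular g₁) (hg₂ : TriMorphism.IsUpperTriangular g₂)
    (s t p q : ℕ) (hs : 1 ≤ s) (ht : 1 ≤ t) (hp : 2 ≤ p) (hq : 2 ≤ q)
    (γ₁ γ₂ δ₁ δ₂ : ℕ) (α : Fin (p - 1) → ℕ) (β : Fin (q - 1) → ℕ)
    (hg₁a : g₁ TriMorphism.a = TriMorphism.a ^ s)
    (hg₁b : g₁ TriMorphism.b = TriMorphism.word γ₁ α γ₂)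
    (hg₂a : g₂ TriMorphism.a = TriMorphism.a ^ t)
    (hg₂b : g₂ TriMorphism.b = TriMorphism.word δ₁ β δ₂)
    (m n r : ℕ) (hm : 0 < m) (hn : 0 < n) (hr : 0 < r)
    (hpr : p = r ^ m) (hqr : q = r ^ n) :
    g₁ * g₂ = g₂ * g₁ ↔
      (g₁ ^ n = g₂ ^ m ∨
        (g₁ TriMorphism.b ∈ Submonoid.powers TriMorphism.b ∧
          g₂ TriMorphism.b ∈ Submonoid.powers TriMorphism.b) ∨
        (g₁ TriMorphism.a = TriMorphism.a ∧ g₂ TriMorphism.a = TriMorphism.a ∧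
          TriMorphism.AConjugates ((g₁ ^ n) TriMorphism.b) ((g₂ ^ m) TriMorphism.b))) := by
  open TriMorphism in
  obtain ⟨V, hV, hgV⟩ := exists_selfSimilar_hasGaps hp α hg₁a hg₁b
  obtain ⟨W, hW, hgW⟩ := exists_selfSimilar_hasGaps hq β hg₂a hg₂b
  have hPQ : q ^ m = p ^ n := by rw [hpr, hqr, ← pow_mul, ← pow_mul, mul_comm]
  have hpP : p ≤ p ^ n := Nat.le_self_pow hn.ne' p
  have hqP : q ≤ p ^ n := hPQ ▸ Nat.le_self_pow hm.ne' q
  have hP : 1 < p ^ n := by omega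
  have hVn := hV.pow (by omega) n
  have hWm := hW.pow (by omega) m
  have h₁ := hgV.pow hV (by omega) n
  have h₂ := hgW.pow hW (by omega) m
  rw [hPQ] at hWm h₂
  have comm_of_agree (hst : s ^ n = t ^ m)
      (hk : (γ₁ + γ₂) * geom s n = (δ₁ + δ₂) * geom t m) (hVW : ∀ i < p ^ n, V i = W i)
      (he₁ : s * δ₁ + γ₁ = t * γ₁ + δ₁) (he₂ : s * δ₂ + γ₂ = t * γ₂ + δ₂) :
      g₁ * g₂ = g₂ * g₁ := by
    rw [hst, hk] at hVn
    obtain rfl := hVn.unique hWm hP hVW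
    exact hgV.mul_comm_of hgW hV hW (by omega) (by omega) he₁ he₂
  constructor
  · intro hcomm
    have hpow : g₁ ^ n * g₂ ^ m = g₂ ^ m * g₁ ^ n := Commute.pow_pow hcomm n m
    obtain ⟨hVW, he₁, he₂, hgap⟩ := h₁.of_mul_comm h₂ hP hpow
    by_cases hST : s ^ n = t ^ m
    · by_cases hs1 : s = 1
      · have ht1 : t = 1 := by
          rw [hs1, one_pow] at hST
          exact (Nat.pow_eq_one.1 hST.symm).resolve_right hm.ne'
        -- With `S = T`, a single inner gap, available since `P > 1`, already equates the sums of
        -- outer exponents.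
        have hk := hgap 1 one_pos hP
        rw [hST] at hk
        refine Or.inr (Or.inr ⟨by rw [hg₁a, hs1, pow_one], by rw [hg₂a, ht1, pow_one], ?_⟩)
        exact ⟨_, _, _, _, blocks V (p ^ n), h₁.map_b,
          by rw [h₂.map_b, blocks_congr hVW], by omega⟩
      · left
        have hS : 1 < s ^ n := Nat.one_lt_pow hn.ne' (by omega)
        rw [← hST] at he₁ he₂ h₂
        have key {x y : ℕ} (h : s ^ n * y + x = s ^ n * x + y) : x = y := by
          obtain ⟨k, hk⟩ := Nat.exists_eq_add_of_lt hS
          rw [hk] at h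
          have : (k + 1) * y = (k + 1) * x := by linarith
          exact (Nat.eq_of_mul_eq_mul_left k.succ_pos this).symm
        rw [← key he₁, ← key he₂] at h₂
        exact h₁.ext h₂ hVW
    · right; left
      have hS : 1 ≤ s ^ n := Nat.one_le_pow _ _ hs
      have hT : 1 ≤ t ^ m := Nat.one_le_pow _ _ ht
      -- The first equation required is the sum of `he₁` and `he₂`.
      have key (i : ℕ) (h0 : 0 < i) (hi : i < p ^ n) :=
        eq_zero_of_ne hS hT hST (by linarith) (hgap i h0 hi)
      have hV0 : ∀ i < p ^ n, V i = 0 := fun i hi => by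
        rcases Nat.eq_zero_or_pos i with rfl | h0
        exacts [hgV.zero, (key i h0 hi).2.2]
      exact ⟨hgV.map_b_eq_pow hn (key 1 one_pos hP).1 fun i hi => hV0 i (by omega),
        hgW.map_b_eq_pow hm (key 1 one_pos hP).2.1 fun i hi => by
          rw [← hVW i (by omega), hV0 i (by omega)]⟩
  · rintro (h | ⟨⟨k, hk⟩, ⟨l, hl⟩⟩ | ⟨ha₁, ha₂, hc⟩)
    · rw [← h] at h₂
      obtain ⟨hst, hc, hd, hVW⟩ := h₁.inj h₂ (by omega)
      exact comm_of_agree hst (by linarith) hVW (mul_add_eq_of_geom hn hm hst hc)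
        (mul_add_eq_of_geom hn hm hst hd)
    · simp only at hk hl
      refine hom_ext ?_ ?_
      · rw [mul_apply, mul_apply, hg₁a, hg₂a, map_pow, map_pow, hg₁a, hg₂a,
          ← pow_mul, ← pow_mul, mul_comm]
      · rw [mul_apply, mul_apply, ← hk, ← hl, map_pow, map_pow, ← hk, ← hl,
          ← pow_mul, ← pow_mul, mul_comm]
    · obtain rfl : s = 1 := a_pow_injective (by simp only [← hg₁a, ha₁, pow_one])
      obtain rfl : t = 1 := a_pow_injective (by simp only [← hg₂a, ha₂, pow_one])
      obtain ⟨hk, hVW⟩ := h₁.of_aConjugates h₂ (by omega) hc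
      -- With `s = t = 1` the conditions on outer exponents hold by commutativity of addition.
      exact comm_of_agree (by simp) (by linarith) hVW (by omega) (by omega)
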